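/- **Setting.** Let $R$ be a Noetherian local ring with maximal ideal $\mathfrak m$; algebras are commutative with unity. A *closure operation* cl on $R$ assigns to every submodule $N$ of a finitely generated $R$-module $M$ a submodule $N^{\mathrm{cl}}_M\subseteq M$ such that $N\subseteq N^{\mathrm{cl}}_M=(N^{\mathrm{cl}}_M)^{\mathrm{cl}}_M$, and $N^{\mathrm{cl}}_M\subseteq (N')^{\mathrm{cl}}_M$ whenever $N\subseteq N'\subseteq M$. Closure operations are ordered by $\mathrm{cl}\le\mathrm{cl}'$ iff $N^{\mathrm{cl}}_M\subseteq N^{\mathrm{cl}'}_M$ for all $N\subseteq M$. For an $R$-algebra $S$, the *algebra closure* $\mathrm{cl}_S$ is defined by: $u\in N_M^{\mathrm{cl}_S}$ iff $s\otimes u\in\operatorname{im}(S\otimes_R N\to S\otimes_R M)$ for all $s\in S$. A *big Cohen–Macaulay algebra* for $R$ is an $R$-algebra $B$ such that every system of parameters of $R$ is a regular sequence on $B$ (in particular $\mathfrak mB\neq B$). A *big Cohen–Macaulay algebra closure* is a closure $\mathrm{cl}_B$ with $B$ a big Cohen–Macaulay algebra for $R$. **Modifications.** A *parameter relation* in an $R$-module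 $M$ is an equation $x_{k+1}m_{k+1}=\sum_{i\le k}x_im_i$ with $m_1,\dots,m_{k+1}\in M$ and $x_1,\dots,x_{k+1}$ part of a system of parameters of $R$ ($k\ge0$); a linear map $g\colon M\to P$ *trivializes* it if $g(m_{k+1})\in(x_1,\dots,x_k)P$. The *module modification* of $M$ along it is $M\to M'=(M\oplus RX_1\oplus\dots\oplus RX_k)/R(m_{k+1}-\sum x_iX_i)$. If $M=S$ is an $R$-algebra, the *algebra modification* of $S$ along it is $S\to S[X_1,\dots,X_k]/(m_{k+1}-\sum x_iX_i)$. More generally one modifies simultaneously along any family of parameter relations, with a separate set of new variables for each relation. **Two constructions.** (A) *Algebra modifications.* $B$ is the direct limit of a sequence of $R$-algebras $R=S_0\to S_1\to S_2\to\cdots$ such that each $S_n\to S_{n+1}$ is an algebra modification along some family of parameter relations in $S_n$, and every parameter relation in any $S_n$ is trivialized by $S_n\to S_m$ for some $m\ge n$. (B) *Module modifications and symmetric algebras.* $B$ is the direct limit of a sequence of $R$-algebras $R=A_0\to A_1\to A_2\to\cdots$, where $A_{n+1}$ is obtained from $A_n$ in two steps. First, $A_n\to P_n$ is the direct limit of a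 sequence of $R$-modules $A_n=M_0\to M_1\to\cdots$ in which each map is a module modification along some family of parameter relations and every parameter relation in any $M_i$ is trivialized in a later $M_j$. Second, writing $f\colon A_n\to P_n$ for the resulting map and $e=f(1)$, one takes $A_{n+1}=\mathrm{Sym}_R(P_n)/(1-e)\,\mathrm{Sym}_R(P_n)$, formed as an algebra under $A_n$, i.e. one also imposes the relations $f(a)f(b)=f(ab)$ for $a,b\in A_n$ (automatic for $n=0$), so that $A_n\to A_{n+1}$ is a ring homomorphism. **Proposition.** Suppose $R$ has a big Cohen–Macaulay algebra. Then $R$ has a smallest big Cohen–Macaulay algebra closure $\mathrm{cl}$. Moreover, $R$-algebras $B$ as in (A) and as in (B) exist, and every such $B$, of either kind, is a big Cohen–Macaulay algebra for $R$ with $\mathrm{cl}_B=\mathrm{cl}$. -/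

import Mathlib

open IsLocalRing

universe u v

/-! ### Closure operations -/

/-- A closure operation on `R`: an assignment `N ↦ N^cl_M` for submodules `N` of finitely generated
`R`-modules `M` that is extensive, idempotent and order-preserving. -/
@[ext]
structure ClosureOperation (R : Type u) [CommRing R] where
  cl : ∀ (M : Type u) [AddCommGroup M] [Module R M] [Module.Finite R M],
    Submodule R M → Submodule R M
  extension : ∀ (M : Type u) [AddCommGroup M] [Module R M] [Module.Finite R M]
    (N : Submodule R M), N ≤ cl M N
  idempotent : ∀ (M : Type u) [AddCommGroup M] [Module R M] [Module.Finite R M]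
    (N : Submodule R M), cl M (cl M N) = cl M N
  order_preserving : ∀ (M : Type u) [AddCommGroup M] [Module R M] [Module.Finite R M]
    (N N' : Submodule R M), N ≤ N' → cl M N ≤ cl M N'

/-- `c ≤ c'` means `N^c_M ⊆ N^{c'}_M` for all submodules `N` of finitely generated modules `M`. -/
instance ClosureOperation.instPartialOrder (R : Type u) [CommRing R] :
    PartialOrder (ClosureOperation R) where
  le c c' := ∀ (M : Type u) [AddCommGroup M] [Module R M] [Module.Finite R M]
    (N : Submodule R M), c.cl M N ≤ c'.cl M N
  le_refl c := fun M _ _ _ N => le_refl (c.cl M N)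
  le_trans a b c hab hbc := fun M _ _ _ N => le_trans (hab M N) (hbc M N)
  le_antisymm a b hab hba := by
    ext M _ _ _ N x
    exact ⟨fun h => hab M N h, fun h => hba M N h⟩

open scoped TensorProduct in
/-- `{u ∈ M | ∀ s ∈ S, s ⊗ u ∈ im (S ⊗ N → S ⊗ M)}`. -/
def moduleClosureSubmodule (R : Type u) [CommRing R] (S : Type v) [AddCommGroup S] [Module R S]
    (M : Type u) [AddCommGroup M] [Module R M] (N : Submodule R M) : Submodule R M where
  carrier := {x | ∀ s : S, s ⊗ₜ[R] x ∈ LinearMap.range (N.subtype.lTensor S)}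
  add_mem' := fun ha hb s => by
    rw [TensorProduct.tmul_add]
    exact Submodule.add_mem _ (ha s) (hb s)
  zero_mem' := fun s => by
    rw [TensorProduct.tmul_zero]
    exact Submodule.zero_mem _
  smul_mem' := fun r x hx s => by
    rw [TensorProduct.tmul_smul]
    exact Submodule.smul_mem _ r (hx s)

open scoped TensorProduct in
theorem le_moduleClosureSubmodule (R : Type u) [CommRing R] (S : Type v) [AddCommGroup S]
    [Module R S] (M : Type u) [AddCommGroup M] [Module R M] (N : Submodule R M) :
    N ≤ moduleClosureSubmodule R S M N :=
  fun x hx s => ⟨s ⊗ₜ[R] (⟨x, hx⟩ : N), by simp⟩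

/-- The module closure `cl_S` of an `R`-module `S`. -/
def moduleClosure (R : Type u) [CommRing R] (S : Type v) [AddCommGroup S] [Module R S] :
    ClosureOperation R where
  cl M _ _ _ N := moduleClosureSubmodule R S M N
  extension M _ _ _ N := le_moduleClosureSubmodule R S M N
  idempotent M _ _ _ N := by
    refine le_antisymm (fun x hx s => ?_) (le_moduleClosureSubmodule R S M _)
    obtain ⟨t, ht⟩ := hx s
    rw [← ht]
    clear ht
    induction t using TensorProduct.induction_on with
    | zero => simp
    | tmul a n => simpa using n.2 a
    | add a b ha hb =>
      rw [map_add]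
      exact Submodule.add_mem _ ha hb
  order_preserving M _ _ _ N N' h := fun x hx s => by
    obtain ⟨t, ht⟩ := hx s
    refine ⟨(Submodule.inclusion h).lTensor S t, ?_⟩
    rw [← ht, ← LinearMap.comp_apply, ← LinearMap.lTensor_comp]
    rfl

/-- The algebra closure `cl_S` of an `R`-algebra `S`. -/
def algebraClosure (R : Type u) [CommRing R] (S : Type v) [CommRing S] [Algebra R S] :
    ClosureOperation R :=
  moduleClosure R S

/-! ### Big Cohen-Macaulay algebras -/

/-- `rs` is a system of parameters of the (Noetherian) local ring `R`. -/
def IsSystemOfParameters (R : Type u) [CommRing R] [IsLocalRing R] (rs : List R) : Prop :=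
  (rs.length : WithBot ℕ∞) = ringKrullDim R ∧ (Ideal.ofList rs).radical = maximalIdeal R

/-- `rs` is part of a system of parameters of `R`. -/
def IsPartialSystemOfParameters (R : Type u) [CommRing R] [IsLocalRing R] (rs : List R) : Prop :=
  ∃ rs' : List R, IsSystemOfParameters R (rs ++ rs')

/-- `B` is a (balanced) big Cohen-Macaulay algebra for `R`: every system of parameters of `R` is
a regular sequence on `B`. (`IsRegular` includes `(x₁, …, x_d) B ≠ B`.) -/
def IsBigCMAlgebra (R : Type u) [CommRing R] [IsLocalRing R]
    (B : Type v) [CommRing B] [Algebra R B] : Prop :=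
  ∀ rs : List R, IsSystemOfParameters R rs → RingTheory.Sequence.IsRegular B rs

/-- `c` is the algebra closure of some big Cohen-Macaulay algebra for `R`. -/
def IsBigCMAlgebraClosure (R : Type u) [CommRing R] [IsLocalRing R]
    (c : ClosureOperation R) : Prop :=
  ∃ (B : Type u) (_ : CommRing B) (_ : Algebra R B),
    IsBigCMAlgebra R B ∧ c = algebraClosure R B

/-! ### Parameter relations and modifications -/

/-- A relation `x_{k+1} m_{k+1} = x₁ m₁ + ⋯ + x_k m_k` in the `R`-module `M`, with
`x₁, …, x_{k+1}` part of a system of parameters of `R`. Here `y = x_{k+1}` and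
`lead = m_{k+1}`. -/
structure ParameterRelation (R : Type u) [CommRing R] [IsLocalRing R]
    (M : Type u) [AddCommGroup M] [Module R M] where
  k : ℕ
  x : Fin k → R
  y : R
  isPartial : IsPartialSystemOfParameters R (List.ofFn x ++ [y])
  coeff : Fin k → M
  lead : M
  relation : y • lead = ∑ j, x j • coeff j

section Modifications

variable {R : Type u} [CommRing R] [IsLocalRing R]

/-- The relation `ρ` in `M` is trivialized by `f : M → P` when `f(m_{k+1}) ∈ (x₁, …, x_k) P`. -/
def ParameterRelation.TrivializedBy {M : Type u} [AddCommGroup M] [Module R M]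
    (ρ : ParameterRelation R M) {P : Type u} [AddCommGroup P] [Module R P]
    (f : M →ₗ[R] P) : Prop :=
  ∃ d : Fin ρ.k → P, f ρ.lead = ∑ j, ρ.x j • d j

/-- For a family of relations `ρ i` in `M`, the submodule of
`M ⊕ ⨁_{i, j ≤ k_i} R X_{i,j}` generated by the elements `m_{i,k_i+1} - ∑_j x_{i,j} X_{i,j}`. -/
noncomputable def moduleModificationRelations {M : Type u} [AddCommGroup M] [Module R M]
    {ι : Type u} (ρ : ι → ParameterRelation R M) :
    Submodule R (M × ((Σ i, Fin (ρ i).k) →₀ R)) :=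
  Submodule.span R (Set.range fun i =>
    ((ρ i).lead, -∑ j, Finsupp.single (⟨i, j⟩ : Σ i, Fin (ρ i).k) ((ρ i).x j)))

/-- `f : M → M'` is a module modification of `M` with respect to a family of relations in `M`,
all of them modified simultaneously. (A family with one member gives the usual module modification
`M' = (M ⊕ R X₁ ⊕ ⋯ ⊕ R X_k) / R (m_{k+1} - ∑ x_i X_i)`.) -/
def IsModuleModification {M M' : Type u} [AddCommGroup M] [Module R M]
    [AddCommGroup M'] [Module R M'] (f : M →ₗ[R] M') : Prop :=
  ∃ (ι : Type u) (ρ : ι → ParameterRelation R M)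
    (e : ((M × ((Σ i, Fin (ρ i).k) →₀ R)) ⧸ moduleModificationRelations ρ) ≃ₗ[R] M'),
    ∀ m : M, f m = e ((moduleModificationRelations ρ).mkQ (m, 0))

/-- For a family of relations `ρ i` in the `R`-algebra `S`, the ideal of the polynomial ring
`S[X_{i,j} : i, j ≤ k_i]` generated by the elements `s_{i,k_i+1} - ∑_j x_{i,j} X_{i,j}`. -/
noncomputable def algebraModificationRelations {S : Type u} [CommRing S] [Algebra R S]
    {ι : Type u} (ρ : ι → ParameterRelation R S) :
    Ideal (MvPolynomial (Σ i, Fin (ρ i).k) S) :=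
  Ideal.span (Set.range fun i =>
    MvPolynomial.C (ρ i).lead -
      ∑ j, (ρ i).x j • MvPolynomial.X (⟨i, j⟩ : Σ i, Fin (ρ i).k))

/-- `f : S → S'` is an algebra modification of `S` with respect to a family of relations in `S`,
all of them modified simultaneously. (A family with one member gives the usual algebra modification
`S' = S[X₁, …, X_k] / (s_{k+1} - ∑ x_i X_i)`.) -/
def IsAlgebraModification {S S' : Type u} [CommRing S] [Algebra R S]
    [CommRing S'] [Algebra R S'] (f : S →ₐ[R] S') : Prop :=
  ∃ (ι : Type u) (ρ : ι → ParameterRelation R S)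
    (e : (MvPolynomial (Σ i, Fin (ρ i).k) S ⧸ algebraModificationRelations ρ) ≃ₐ[R] S'),
    ∀ s : S, f s = e (Ideal.Quotient.mk (algebraModificationRelations ρ) (MvPolynomial.C s))

end Modifications

/-! ### Direct limits of sequences -/

/-- The maps `g n : X n → L` exhibit `L` as the direct limit of the sequence
`X 0 → X 1 → X 2 → ⋯` with transition maps `t`. (For sequences of modules or algebras, the direct
limit is computed on underlying sets.) -/
structure IsSequentialLimit {X : ℕ → Type u} (t : ∀ i j, i ≤ j → X i → X j)
    {L : Type u} (g : ∀ n, X n → L) : Prop where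
  map_self : ∀ i a, t i i le_rfl a = a
  map_map : ∀ i j k (hij : i ≤ j) (hjk : j ≤ k) a,
    t j k hjk (t i j hij a) = t i k (hij.trans hjk) a
  compat : ∀ i j (h : i ≤ j) a, g j (t i j h a) = g i a
  surj : ∀ b, ∃ n a, g n a = b
  eq_of_eq : ∀ n a a', g n a = g n a' → ∃ (m : ℕ) (h : n ≤ m), t n m h a = t n m h a'

/-! ### The construction by algebra modifications -/

/-- `B` is constructed from `R` by algebra modifications: `B` is the direct limit of a sequence of
`R`-algebras `R = S₀ → S₁ → S₂ → ⋯` in which every `Sₙ₊₁` is an algebra modification of `Sₙ` and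
every relation in a stage is trivialized in some later stage. -/
structure AlgebraModificationConstruction (R : Type u) [CommRing R] [IsLocalRing R]
    (B : Type u) [CommRing B] [Algebra R B] where
  S : ℕ → Type u
  [commRing : ∀ n, CommRing (S n)]
  [algebra : ∀ n, Algebra R (S n)]
  base : Function.Bijective (algebraMap R (S 0))
  trans : ∀ i j, i ≤ j → S i →ₐ[R] S j
  step : ∀ n, IsAlgebraModification (trans n (n + 1) n.le_succ)
  trivialized : ∀ n (ρ : ParameterRelation R (S n)),
    ∃ (m : ℕ) (h : n ≤ m), ρ.TrivializedBy (trans n m h).toLinearMap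
  toLimit : ∀ n, S n →ₐ[R] B
  isLimit : IsSequentialLimit (fun i j h => trans i j h) (fun n => toLimit n)

/-! ### The construction by module modifications and symmetric algebras -/

/-- `f : M → P` is obtained by module modifications: `P` is the direct limit of a sequence of
`R`-modules `M = M₀ → M₁ → M₂ → ⋯` in which every `Mₙ₊₁` is a module modification of `Mₙ` and
every relation in a stage is trivialized in some later stage; `f` is the canonical map. -/
structure ModuleModificationConstruction {R : Type u} [CommRing R] [IsLocalRing R]
    {M P : Type u} [AddCommGroup M] [Module R M] [AddCommGroup P] [Module R P]
    (f : M →ₗ[R] P) where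
  N : ℕ → Type u
  [addCommGroup : ∀ n, AddCommGroup (N n)]
  [module : ∀ n, Module R (N n)]
  base : M ≃ₗ[R] N 0
  trans : ∀ i j, i ≤ j → N i →ₗ[R] N j
  step : ∀ n, IsModuleModification (trans n (n + 1) n.le_succ)
  trivialized : ∀ n (ρ : ParameterRelation R (N n)),
    ∃ (m : ℕ) (h : n ≤ m), ρ.TrivializedBy (trans n m h)
  toLimit : ∀ n, N n →ₗ[R] P
  isLimit : IsSequentialLimit (fun i j h => trans i j h) (fun n => toLimit n)
  map_eq : ∀ m, f m = toLimit 0 (base m)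

section SymmetricStep

variable {R : Type u} [CommRing R]

/-- For an `R`-linear map `f : A → P` from an `R`-algebra to an `R`-module, with `e = f 1`, the
ideal of `Sym(P)` generated by `1 - e` and by all `f(a) f(b) - f(ab)`. The second kind of
generator makes `A → P → Sym(P) / I` multiplicative; for `A = R` it already lies in the ideal
`(1 - e) Sym(P)`. -/
noncomputable def symmetricRelations {A P : Type u} [CommRing A] [Algebra R A]
    [AddCommGroup P] [Module R P] (f : A →ₗ[R] P) : Ideal (SymmetricAlgebra R P) :=
  Ideal.span ({1 - SymmetricAlgebra.ι R P (f 1)} ∪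
    Set.range fun p : A × A =>
      SymmetricAlgebra.ι R P (f p.1) * SymmetricAlgebra.ι R P (f p.2) -
        SymmetricAlgebra.ι R P (f (p.1 * p.2)))

/-- `g : A → A'` is, up to isomorphism, the map `A → P → Sym(P) / (1 - e) Sym(P)`, the quotient
being taken as an algebra under `A`. -/
def IsSymmetricStep {A P A' : Type u} [CommRing A] [Algebra R A] [AddCommGroup P] [Module R P]
    [CommRing A'] [Algebra R A'] (f : A →ₗ[R] P) (g : A →ₐ[R] A') : Prop :=
  ∃ e : (SymmetricAlgebra R P ⧸ symmetricRelations f) ≃ₐ[R] A',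
    ∀ a : A, g a = e (Ideal.Quotient.mk (symmetricRelations f) (SymmetricAlgebra.ι R P (f a)))

end SymmetricStep

/-- `B` is constructed from `R` by module modifications and symmetric algebras: `B` is the direct
limit of a sequence of `R`-algebras `R = A₀ → A₁ → A₂ → ⋯`, where `Aₙ₊₁` arises from `Aₙ` by first
building `f n : Aₙ → Pₙ` by module modifications of the `R`-module `Aₙ` and then passing to the
symmetric algebra of `Pₙ`, with the image of `1` identified with `1`. -/
structure SymmetricAlgebraConstruction (R : Type u) [CommRing R] [IsLocalRing R]
    (B : Type u) [CommRing B] [Algebra R B] where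
  A : ℕ → Type u
  [commRing : ∀ n, CommRing (A n)]
  [algebra : ∀ n, Algebra R (A n)]
  base : Function.Bijective (algebraMap R (A 0))
  P : ℕ → Type u
  [addCommGroup : ∀ n, AddCommGroup (P n)]
  [module : ∀ n, Module R (P n)]
  f : ∀ n, A n →ₗ[R] P n
  modification : ∀ n, ModuleModificationConstruction (f n)
  trans : ∀ i j, i ≤ j → A i →ₐ[R] A j
  step : ∀ n, IsSymmetricStep (f n) (trans n (n + 1) n.le_succ)
  toLimit : ∀ n, A n →ₐ[R] B
  isLimit : IsSequentialLimit (fun i j h => trans i j h) (fun n => toLimit n)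

/-! An algebra is big Cohen–Macaulay exactly when all parameter relations in it are trivial
(`RelationsTrivial`) and no system of parameters generates the unit ideal in it. Both constructions
have two properties.

Their relations are trivial: a relation in the limit involves finitely many elements, so it already
holds at some stage, and it is trivialized further on (`IsSequentialLimit.relationsTrivial`).

They map weakly initially: if the relations in `C` are trivial, a map to `C` extends over each
modification by sending the new variables to coefficients that witness triviality in `C`. These
choices, made stage by stage, glue to an algebra map from the limit (`nonempty_algHom`), in general
not a unique one.

Let `B` be such a limit. A map from `B` to a given big Cohen–Macaulay algebra excludes `1 ∈ (x₁, …,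
x_d) B`, so `B` is big Cohen–Macaulay. An algebra map `B → D` gives `cl_B ≤ cl_D`
(`algebraClosure_le_of_algHom`), so `cl_B` is least. Uniqueness of least elements shows that all
these `B` have the same closure. -/

theorem mem_ofList_ofFn_smul_top_iff {R : Type u} [CommRing R] {M : Type v} [AddCommGroup M]
    [Module R M] {k : ℕ} (x : Fin k → R) (z : M) :
    z ∈ Ideal.ofList (List.ofFn x) • (⊤ : Submodule R M) ↔ ∃ d : Fin k → M, z = ∑ j, x j • d j := by
  constructor
  · intro hz
    induction hz using Submodule.smul_induction_on' with
    | smul r hr m _ =>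
      have hr' : r ∈ Ideal.span (Set.range x) := by
        simpa [Ideal.ofList, List.mem_ofFn', Set.range] using hr
      obtain ⟨c, rfl⟩ := Ideal.mem_span_range_iff_exists_fun.1 hr'
      exact ⟨fun j => c j • m, by simp [Finset.sum_smul, smul_smul, mul_comm]⟩
    | add a _ b _ ha hb =>
      obtain ⟨d, rfl⟩ := ha
      obtain ⟨d', rfl⟩ := hb
      exact ⟨d + d', by simp [Finset.sum_add_distrib]⟩
  · rintro ⟨d, rfl⟩
    exact Submodule.sum_mem _ fun j _ =>
      Submodule.smul_mem_smul (Ideal.subset_span (by simp [List.mem_ofFn'])) trivial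

/-! ### Transport of parameter relations along linear maps -/

namespace ParameterRelation

variable {R : Type u} [CommRing R] [IsLocalRing R]
  {M : Type u} [AddCommGroup M] [Module R M] {P : Type u} [AddCommGroup P] [Module R P]
  {Q : Type u} [AddCommGroup Q] [Module R Q]

/-- The image of a parameter relation under a linear map. -/
def map (ρ : ParameterRelation R M) (f : M →ₗ[R] P) : ParameterRelation R P where
  k := ρ.k
  x := ρ.x
  y := ρ.y
  isPartial := ρ.isPartial
  coeff j := f (ρ.coeff j)
  lead := f ρ.lead
  relation := by simpa using congrArg f ρ.relation

theorem TrivializedBy.comp {ρ : ParameterRelation R M} {f : M →ₗ[R] P} (h : ρ.TrivializedBy f)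
    (g : P →ₗ[R] Q) : ρ.TrivializedBy (g ∘ₗ f) := by
  obtain ⟨d, hd⟩ := h
  exact ⟨fun j => g (d j), by simp [hd]⟩

end ParameterRelation

/-- Every parameter relation in `M` is trivial. -/
def RelationsTrivial (R : Type u) [CommRing R] [IsLocalRing R] (M : Type u) [AddCommGroup M]
    [Module R M] : Prop :=
  ∀ ρ : ParameterRelation R M, ρ.TrivializedBy LinearMap.id

theorem RelationsTrivial.trivializedBy {R : Type u} [CommRing R] [IsLocalRing R] {M P : Type u}
    [AddCommGroup M] [Module R M] [AddCommGroup P] [Module R P] (h : RelationsTrivial R P)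
    (ρ : ParameterRelation R M) (f : M →ₗ[R] P) : ρ.TrivializedBy f :=
  h (ρ.map f)

/-! ### Trivial relations, regular sequences and comparison of closures -/

section BigCM

open RingTheory.Sequence

variable {R : Type u} [CommRing R] {B C : Type u} [CommRing B] [Algebra R B]
  [CommRing C] [Algebra R C]

/-- A relation is trivial as soon as `y` is a nonzerodivisor modulo the preceding parameters, which
is one step of regularity. -/
theorem IsBigCMAlgebra.relationsTrivial [IsLocalRing R] (h : IsBigCMAlgebra R C) : RelationsTrivial R C := by
  intro ρ
  obtain ⟨rs', hrs⟩ := ρ.isPartial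
  have h1 := (h _ hrs).toIsWeaklyRegular
  rw [List.append_assoc, isWeaklyRegular_append_iff, List.singleton_append,
    isWeaklyRegular_cons_iff] at h1
  have h2 := (isSMulRegular_quotient_iff_mem_of_smul_mem _ _).1 h1.2.1
  exact (mem_ofList_ofFn_smul_top_iff _ _).1
    (h2 _ ((mem_ofList_ofFn_smul_top_iff _ _).2 ⟨ρ.coeff, ρ.relation⟩))

theorem RelationsTrivial.isWeaklyRegular [IsLocalRing R] {M : Type u} [AddCommGroup M] [Module R M]
    (h : RelationsTrivial R M) {rs : List R} (hrs : IsSystemOfParameters R rs) :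
    IsWeaklyRegular M rs := by
  refine ⟨fun i hi => (isSMulRegular_quotient_iff_mem_of_smul_mem _ _).2 fun z hz => ?_⟩
  obtain ⟨x, hx⟩ : ∃ x : Fin (rs.take i).length → R, rs.take i = List.ofFn x :=
    ⟨_, (List.ofFn_get _).symm⟩
  rw [hx, mem_ofList_ofFn_smul_top_iff] at hz ⊢
  obtain ⟨c, hc⟩ := hz
  -- The parameters before position `i` play the role of `x`; those after it complete the system.
  refine h ⟨_, x, rs[i], ⟨rs.drop (i + 1), ?_⟩, c, z, hc⟩
  rw [← hx]
  simpa using hrs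

/-- Given trivial relations, only properness of the parameter ideal is left, and properness pulls
back: an expression of `1` in `B` maps to one in `C`. -/
theorem IsBigCMAlgebra.of_algHom [IsLocalRing R] (hC : IsBigCMAlgebra R C) (f : B →ₐ[R] C)
    (hB : RelationsTrivial R B) : IsBigCMAlgebra R B := by
  refine fun rs hrs => ⟨hB.isWeaklyRegular hrs, fun htop => (hC rs hrs).top_ne_smul ?_⟩
  obtain ⟨x, hx⟩ : ∃ x : Fin rs.length → R, rs = List.ofFn x := ⟨_, (List.ofFn_get _).symm⟩
  have h1 : (1 : B) ∈ Ideal.ofList rs • (⊤ : Submodule R B) := htop ▸ trivial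
  rw [hx, mem_ofList_ofFn_smul_top_iff] at h1
  obtain ⟨d, hd⟩ := h1
  refine (eq_top_iff.2 fun z _ => ?_).symm
  rw [hx, mem_ofList_ofFn_smul_top_iff]
  refine ⟨fun j => f (d j) * z, ?_⟩
  have h2 : (1 : C) = ∑ j, x j • f (d j) := by simpa using congrArg f hd
  simpa [Finset.sum_mul] using congrArg (· * z) h2

open scoped TensorProduct in
-- Membership at `1 : B` suffices: the map `b ↦ s * f b` carries `1 ⊗ z` to `s ⊗ z` and preserves
-- the image of the tensor product with `N`.
theorem algebraClosure_le_of_algHom (f : B →ₐ[R] C) :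
    algebraClosure R B ≤ algebraClosure R C := by
  intro M _ _ _ N z hz s
  obtain ⟨t, ht⟩ := hz 1
  let φ : B →ₗ[R] C := LinearMap.mulLeft R s ∘ₗ f.toLinearMap
  refine ⟨φ.rTensor N t, ?_⟩
  have h : N.subtype.lTensor C (φ.rTensor N t) = φ.rTensor M (N.subtype.lTensor B t) := by
    simp only [← LinearMap.comp_apply, LinearMap.lTensor_comp_rTensor,
      LinearMap.rTensor_comp_lTensor]
  rw [h, ht]
  simp [φ]

end BigCM

/-! ### Sequential limits -/

namespace IsSequentialLimit

section Sets

variable {X : ℕ → Type u} {t : ∀ i j, i ≤ j → X i → X j} {L : Type u} {g : ∀ n, X n → L}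

theorem exists_stage (h : IsSequentialLimit t g) {ι : Type*} [Fintype ι] (b : ι → L) :
    ∃ (n : ℕ) (a : ι → X n), ∀ i, g n (a i) = b i := by
  choose m a ha using fun i => h.surj (b i)
  have hm : ∀ i, m i ≤ Finset.univ.sup m := fun i => Finset.le_sup (Finset.mem_univ i)
  exact ⟨Finset.univ.sup m, fun i => t _ _ (hm i) (a i), fun i => by rw [h.compat, ha]⟩

/-- Extensions are chosen rather than canonical, so the compatible family comes from recursion. The
predicate `good` stands for linearity or being an algebra map, so one argument on sets serves both
cases. -/
theorem exists_desc (h : IsSequentialLimit t g) {C : Type v} (good : ∀ n, (X n → C) → Prop)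
    (φ₀ : X 0 → C) (h₀ : good 0 φ₀)
    (hstep : ∀ n φ, good n φ → ∃ ψ, good (n + 1) ψ ∧ ∀ a, ψ (t n (n + 1) n.le_succ a) = φ a) :
    ∃ Φ : L → C, (∀ n, good n fun a => Φ (g n a)) ∧ ∀ a, Φ (g 0 a) = φ₀ a := by
  choose ψ hψ hψt using hstep
  let φ' : ∀ n, {φ : X n → C // good n φ} := fun n =>
    Nat.rec ⟨φ₀, h₀⟩ (fun n φ => ⟨ψ n φ.1 φ.2, hψ n φ.1 φ.2⟩) n
  let φ : ∀ n, X n → C := fun n => (φ' n).1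
  have hφ : ∀ n, good n (φ n) := fun n => (φ' n).2
  have hcomp : ∀ i j (hij : i ≤ j) a, φ j (t i j hij a) = φ i a := by
    intro i j hij a
    induction j, hij using Nat.le_induction with
    | base => rw [h.map_self]
    | succ j hij ih =>
      rw [← h.map_map i j (j + 1) hij j.le_succ, ← ih]
      exact hψt j _ (hφ j) _
  choose m a ha using h.surj
  have hΦ : ∀ n b, φ (m (g n b)) (a (g n b)) = φ n b := by
    intro n b
    -- Two representatives of one element are moved to a common stage and then agree at a later
    -- stage `l`, so the value does not depend on the representative.
    obtain ⟨l, hl, hl'⟩ := h.eq_of_eq (max (m (g n b)) n)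
      (t _ _ (le_max_left _ _) (a (g n b))) (t _ _ (le_max_right _ _) b) (by
        rw [h.compat, h.compat, ha])
    rw [h.map_map, h.map_map] at hl'
    rw [← hcomp _ l ((le_max_left _ _).trans hl), hl', hcomp]
  refine ⟨fun b => φ (m b) (a b), fun n => ?_, hΦ 0⟩
  simpa only [hΦ] using hφ n

end Sets

variable {R : Type u} [CommRing R]

section Modules

variable {X : ℕ → Type u} [∀ n, AddCommGroup (X n)] [∀ n, Module R (X n)]
  {t : ∀ i j, i ≤ j → X i →ₗ[R] X j} {L : Type u} [AddCommGroup L] [Module R L]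
  {g : ∀ n, X n →ₗ[R] L}

theorem exists_linearMap_desc (h : IsSequentialLimit (fun i j h => t i j h) (fun n => g n))
    {C : Type u} [AddCommGroup C] [Module R C] (φ₀ : X 0 →ₗ[R] C)
    (hstep : ∀ n (φ : X n →ₗ[R] C), ∃ ψ : X (n + 1) →ₗ[R] C, ψ ∘ₗ t n (n + 1) n.le_succ = φ) :
    ∃ Φ : L →ₗ[R] C, Φ ∘ₗ g 0 = φ₀ := by
  obtain ⟨Φ, hΦ, hΦ₀⟩ := h.exists_desc (fun n φ => ∃ φ' : X n →ₗ[R] C, ⇑φ' = φ) φ₀ ⟨φ₀, rfl⟩ (by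
    rintro n _ ⟨φ, rfl⟩
    obtain ⟨ψ, hψ⟩ := hstep n φ
    exact ⟨ψ, ⟨ψ, rfl⟩, fun a => LinearMap.congr_fun hψ a⟩)
  choose φ hφ using hΦ
  refine ⟨⟨⟨Φ, fun x y => ?_⟩, fun r x => ?_⟩, LinearMap.ext hΦ₀⟩
  · obtain ⟨n, a, ha⟩ := h.exists_stage ![x, y]
    have hx : g n (a 0) = x := ha 0
    have hy : g n (a 1) = y := ha 1
    have := fun z => congrFun (hφ n) z
    rw [← hx, ← hy, ← map_add, ← this, ← this, ← this, map_add]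
  · obtain ⟨n, a, rfl⟩ := h.surj x
    have := fun z => congrFun (hφ n) z
    simp only [RingHom.id_apply]
    rw [← map_smul, ← this, ← this, map_smul]

theorem relationsTrivial [IsLocalRing R]
    (h : IsSequentialLimit (fun i j h => t i j h) (fun n => g n))
    (hg : ∀ n (ρ : ParameterRelation R (X n)), ρ.TrivializedBy (g n)) :
    RelationsTrivial R L := by
  intro ρ
  -- Indexing by `Option` lifts the lead (`none`) and all coefficients (`some j`) to the same stage.
  obtain ⟨n, a, ha⟩ := h.exists_stage (fun o : Option (Fin ρ.k) => o.elim ρ.lead ρ.coeff)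
  have h0 : g n (a none) = ρ.lead := ha none
  have h1 : ∀ j, g n (a (some j)) = ρ.coeff j := fun j => ha (some j)
  -- The lifted elements satisfy the relation only in the limit, hence at a later stage `m`.
  obtain ⟨m, hm, hm'⟩ := h.eq_of_eq n (ρ.y • a none) (∑ j, ρ.x j • a (some j)) (by
    simp only [map_smul, map_sum, h0, h1]
    exact ρ.relation)
  obtain ⟨d, hd⟩ := hg m ⟨ρ.k, ρ.x, ρ.y, ρ.isPartial, fun j => t n m hm (a (some j)),
    t n m hm (a none), by simpa using hm'⟩
  refine ⟨d, Eq.trans ?_ hd⟩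
  exact h0.symm.trans (h.compat n m hm (a none)).symm

end Modules

theorem exists_algHom_desc {X : ℕ → Type u} [∀ n, CommRing (X n)] [∀ n, Algebra R (X n)]
    {t : ∀ i j, i ≤ j → X i →ₐ[R] X j} {L : Type u} [CommRing L] [Algebra R L]
    {g : ∀ n, X n →ₐ[R] L} (h : IsSequentialLimit (fun i j h => t i j h) (fun n => g n))
    (h₀ : Function.Bijective (algebraMap R (X 0))) {C : Type u} [CommRing C] [Algebra R C]
    (hstep : ∀ n (φ : X n →ₐ[R] C), ∃ ψ : X (n + 1) →ₐ[R] C,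
      ψ.comp (t n (n + 1) n.le_succ) = φ) :
    Nonempty (L →ₐ[R] C) := by
  let φ₀ : X 0 →ₐ[R] C :=
    (Algebra.ofId R C).comp (AlgEquiv.ofBijective (Algebra.ofId R (X 0)) h₀).symm.toAlgHom
  obtain ⟨Φ, hΦ, -⟩ := h.exists_desc (fun n φ => ∃ φ' : X n →ₐ[R] C, ⇑φ' = φ) φ₀ ⟨φ₀, rfl⟩ (by
    rintro n _ ⟨φ, rfl⟩
    obtain ⟨ψ, hψ⟩ := hstep n φ
    exact ⟨ψ, ⟨ψ, rfl⟩, fun a => AlgHom.congr_fun hψ a⟩)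
  choose φ hφ using hΦ
  have key : ∀ n z, Φ (g n z) = φ n z := fun n z => (congrFun (hφ n) z).symm
  have hpair : ∀ x y, ∃ n a b, g n a = x ∧ g n b = y := fun x y => by
    obtain ⟨n, a, ha⟩ := h.exists_stage ![x, y]
    exact ⟨n, a 0, a 1, ha 0, ha 1⟩
  refine ⟨{ toFun := Φ, map_one' := ?_, map_mul' := fun x y => ?_, map_zero' := ?_,
            map_add' := fun x y => ?_, commutes' := fun r => ?_ }⟩
  · rw [← map_one (g 0), key, map_one]
  · obtain ⟨n, a, b, rfl, rfl⟩ := hpair x y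
    rw [← map_mul, key, key, key, map_mul]
  · rw [← map_zero (g 0), key, map_zero]
  · obtain ⟨n, a, b, rfl, rfl⟩ := hpair x y
    rw [← map_add, key, key, key, map_add]
  · rw [← (g 0).commutes, key, AlgHom.commutes]

end IsSequentialLimit

/-! ### Maps out of modifications -/

section Lifting

variable {R : Type u} [CommRing R]

theorem IsModuleModification.exists_lift [IsLocalRing R] {M M' C : Type u} [AddCommGroup M]
    [Module R M] [AddCommGroup M'] [Module R M'] [AddCommGroup C] [Module R C] {f : M →ₗ[R] M'}
    (hf : IsModuleModification f) (hC : RelationsTrivial R C) (φ : M →ₗ[R] C) :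
    ∃ ψ : M' →ₗ[R] C, ψ ∘ₗ f = φ := by
  obtain ⟨ι, ρ, e, he⟩ := hf
  choose d hd using fun i => hC.trivializedBy (ρ i) φ
  let Ψ : M × ((Σ i, Fin (ρ i).k) →₀ R) →ₗ[R] C :=
    -- Each new generator goes to the coefficient `d` trivializing the image of its relation in `C`.
    φ.coprod (Finsupp.linearCombination R fun p : Σ i, Fin (ρ i).k => d p.1 p.2)
  have hΨ : moduleModificationRelations ρ ≤ LinearMap.ker Ψ := by
    refine Submodule.span_le.2 ?_
    rintro _ ⟨i, rfl⟩
    simp [Ψ, hd i]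
  refine ⟨(moduleModificationRelations ρ).liftQ Ψ hΨ ∘ₗ e.symm.toLinearMap, ?_⟩
  ext m
  simp [he, Ψ]

theorem IsAlgebraModification.exists_lift [IsLocalRing R] {S S' C : Type u} [CommRing S]
    [Algebra R S] [CommRing S'] [Algebra R S'] [CommRing C] [Algebra R C] {f : S →ₐ[R] S'}
    (hf : IsAlgebraModification f) (hC : RelationsTrivial R C) (φ : S →ₐ[R] C) :
    ∃ ψ : S' →ₐ[R] C, ψ.comp f = φ := by
  obtain ⟨ι, ρ, e, he⟩ := hf
  choose d hd using fun i => hC.trivializedBy (ρ i) φ.toLinearMap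
  let Ψ : MvPolynomial (Σ i, Fin (ρ i).k) S →ₐ[R] C :=
    MvPolynomial.aevalTower φ fun p : Σ i, Fin (ρ i).k => d p.1 p.2
  have hΨ : algebraModificationRelations ρ ≤ RingHom.ker Ψ := by
    refine Ideal.span_le.2 ?_
    rintro _ ⟨i, rfl⟩
    have := hd i
    simp only [AlgHom.toLinearMap_apply] at this
    simp [Ψ, this]
  refine ⟨(Ideal.Quotient.liftₐ (algebraModificationRelations ρ) Ψ fun a ha => hΨ ha).comp
    e.symm.toAlgHom, ?_⟩
  ext s
  have h : Ideal.Quotient.liftₐ (algebraModificationRelations ρ) Ψ (fun a ha => hΨ ha)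
      (Ideal.Quotient.mk _ (MvPolynomial.C s)) = Ψ (MvPolynomial.C s) :=
    Ideal.Quotient.liftₐ_apply ..
  simpa [he, Ψ] using h

theorem ModuleModificationConstruction.exists_lift [IsLocalRing R] {M P C : Type u}
    [AddCommGroup M] [Module R M] [AddCommGroup P] [Module R P] [AddCommGroup C] [Module R C]
    {f : M →ₗ[R] P} (hf : ModuleModificationConstruction f) (hC : RelationsTrivial R C)
    (φ : M →ₗ[R] C) : ∃ ψ : P →ₗ[R] C, ψ ∘ₗ f = φ := by
  let _ := hf.addCommGroup
  let _ := hf.module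
  obtain ⟨Φ, hΦ⟩ := hf.isLimit.exists_linearMap_desc (φ ∘ₗ hf.base.symm.toLinearMap)
    fun n φ => (hf.step n).exists_lift hC φ
  refine ⟨Φ, LinearMap.ext fun m => ?_⟩
  simpa [hf.map_eq] using LinearMap.congr_fun hΦ (hf.base m)

theorem ModuleModificationConstruction.trivializedBy [IsLocalRing R] {M P : Type u}
    [AddCommGroup M] [Module R M] [AddCommGroup P] [Module R P] {f : M →ₗ[R] P}
    (hf : ModuleModificationConstruction f) (ρ : ParameterRelation R M) : ρ.TrivializedBy f := by
  let _ := hf.addCommGroup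
  let _ := hf.module
  obtain ⟨m, hm, hρ⟩ := hf.trivialized 0 (ρ.map hf.base.toLinearMap)
  obtain ⟨d, hd⟩ := hρ.comp (hf.toLimit m)
  refine ⟨d, Eq.trans ?_ hd⟩
  rw [hf.map_eq]
  exact (hf.isLimit.compat 0 m hm _).symm

/-- A linear extension of `φ` to `P` is enough: it extends to the symmetric algebra, and the imposed
relations concern only elements of `f(A)`, where `ψ` agrees with the ring map `φ`. -/
theorem IsSymmetricStep.exists_lift {A P A' C : Type u} [CommRing A] [Algebra R A]
    [AddCommGroup P] [Module R P] [CommRing A'] [Algebra R A'] [CommRing C] [Algebra R C]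
    {f : A →ₗ[R] P} {g : A →ₐ[R] A'} (hg : IsSymmetricStep f g) (φ : A →ₐ[R] C)
    (hφ : ∃ ψ : P →ₗ[R] C, ψ ∘ₗ f = φ.toLinearMap) : ∃ ψ : A' →ₐ[R] C, ψ.comp g = φ := by
  obtain ⟨e, he⟩ := hg
  obtain ⟨ψ, hψ⟩ := hφ
  have hψ' : ∀ a, ψ (f a) = φ a := fun a => LinearMap.congr_fun hψ a
  have hker : symmetricRelations f ≤ RingHom.ker (SymmetricAlgebra.lift ψ) := by
    refine Ideal.span_le.2 ?_
    rintro _ (rfl | ⟨p, rfl⟩) <;> simp [hψ']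
  refine ⟨(Ideal.Quotient.liftₐ (symmetricRelations f) (SymmetricAlgebra.lift ψ)
    fun a ha => hker ha).comp e.symm.toAlgHom, ?_⟩
  ext a
  have h : Ideal.Quotient.liftₐ (symmetricRelations f) (SymmetricAlgebra.lift ψ)
      (fun a ha => hker ha) (Ideal.Quotient.mk _ (SymmetricAlgebra.ι R P (f a))) =
        SymmetricAlgebra.lift ψ (SymmetricAlgebra.ι R P (f a)) :=
    Ideal.Quotient.liftₐ_apply ..
  simpa [he, hψ'] using h

/-- Relations trivialized in `P` stay trivialized in `A'` by composing with `p`. -/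
theorem IsSymmetricStep.exists_factor {A P A' : Type u} [CommRing A] [Algebra R A]
    [AddCommGroup P] [Module R P] [CommRing A'] [Algebra R A'] {f : A →ₗ[R] P} {g : A →ₐ[R] A'}
    (hg : IsSymmetricStep f g) : ∃ p : P →ₗ[R] A', p ∘ₗ f = g.toLinearMap := by
  obtain ⟨e, he⟩ := hg
  refine ⟨e.toLinearMap ∘ₗ (Ideal.Quotient.mkₐ R (symmetricRelations f)).toLinearMap ∘ₗ
    SymmetricAlgebra.ι R P, LinearMap.ext fun a => ?_⟩
  simp [he]

end Lifting

/-! ### Trivial relations in, and maps out of, the two constructions -/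

section Constructions

variable {R : Type u} [CommRing R] [IsLocalRing R] {B : Type u} [CommRing B] [Algebra R B]

theorem AlgebraModificationConstruction.relationsTrivial
    (hB : AlgebraModificationConstruction R B) : RelationsTrivial R B := by
  let _ := hB.commRing
  let _ := hB.algebra
  refine IsSequentialLimit.relationsTrivial (t := fun i j h => (hB.trans i j h).toLinearMap)
    (g := fun n => (hB.toLimit n).toLinearMap) hB.isLimit fun n ρ => ?_
  obtain ⟨m, hm, hρ⟩ := hB.trivialized n ρ
  convert hρ.comp (hB.toLimit m).toLinearMap using 1
  exact LinearMap.ext fun a => (hB.isLimit.compat n m hm a).symm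

theorem AlgebraModificationConstruction.nonempty_algHom
    (hB : AlgebraModificationConstruction R B) {C : Type u} [CommRing C] [Algebra R C]
    (hC : RelationsTrivial R C) : Nonempty (B →ₐ[R] C) := by
  let _ := hB.commRing
  let _ := hB.algebra
  exact hB.isLimit.exists_algHom_desc hB.base fun n φ => (hB.step n).exists_lift hC φ

theorem SymmetricAlgebraConstruction.relationsTrivial
    (hB : SymmetricAlgebraConstruction R B) : RelationsTrivial R B := by
  let _ := hB.commRing
  let _ := hB.algebra
  let _ := hB.addCommGroup
  let _ := hB.module
  refine IsSequentialLimit.relationsTrivial (t := fun i j h => (hB.trans i j h).toLinearMap)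
    (g := fun n => (hB.toLimit n).toLinearMap) hB.isLimit fun n ρ => ?_
  obtain ⟨p, hp⟩ := (hB.step n).exists_factor
  have hρ := (((hB.modification n).trivializedBy ρ).comp p).comp (hB.toLimit (n + 1)).toLinearMap
  rw [hp] at hρ
  convert hρ using 1
  exact LinearMap.ext fun a => (hB.isLimit.compat n (n + 1) n.le_succ a).symm

theorem SymmetricAlgebraConstruction.nonempty_algHom
    (hB : SymmetricAlgebraConstruction R B) {C : Type u} [CommRing C] [Algebra R C]
    (hC : RelationsTrivial R C) : Nonempty (B →ₐ[R] C) := by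
  let _ := hB.commRing
  let _ := hB.algebra
  let _ := hB.addCommGroup
  let _ := hB.module
  exact hB.isLimit.exists_algHom_desc hB.base fun n φ =>
    (hB.step n).exists_lift φ ((hB.modification n).exists_lift hC φ.toLinearMap)

end Constructions

/-! ### Existence of the constructions -/

section Towers

variable {R : Type u} [CommRing R]

/-- The transition maps of a sequence of `R`-modules. -/
def LinearMap.natLERec {X : ℕ → Type u} [∀ n, AddCommGroup (X n)] [∀ n, Module R (X n)]
    (s : ∀ n, X n →ₗ[R] X (n + 1)) (i j : ℕ) (h : i ≤ j) : X i →ₗ[R] X j :=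
  Nat.leRec (motive := fun j _ => X i →ₗ[R] X j) LinearMap.id (fun {j} _ f => s j ∘ₗ f) h

/-- The transition maps of a sequence of `R`-algebras. -/
def AlgHom.natLERec {X : ℕ → Type u} [∀ n, CommRing (X n)] [∀ n, Algebra R (X n)]
    (s : ∀ n, X n →ₐ[R] X (n + 1)) (i j : ℕ) (h : i ≤ j) : X i →ₐ[R] X j :=
  Nat.leRec (motive := fun j _ => X i →ₐ[R] X j) (AlgHom.id R _) (fun {j} _ f => (s j).comp f) h

section Linear

variable {X : ℕ → Type u} [∀ n, AddCommGroup (X n)] [∀ n, Module R (X n)]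
  (s : ∀ n, X n →ₗ[R] X (n + 1))

theorem LinearMap.natLERec_self (i : ℕ) : LinearMap.natLERec s i i le_rfl = LinearMap.id :=
  Nat.leRec_self ..

theorem LinearMap.natLERec_succ (i j : ℕ) (h : i ≤ j) :
    LinearMap.natLERec s i (j + 1) (h.trans j.le_succ) = s j ∘ₗ LinearMap.natLERec s i j h :=
  Nat.leRec_succ ..

theorem LinearMap.natLERec_step (i : ℕ) : LinearMap.natLERec s i (i + 1) i.le_succ = s i := by
  rw [LinearMap.natLERec_succ s i i le_rfl, LinearMap.natLERec_self, LinearMap.comp_id]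

instance LinearMap.natLERec_directedSystem :
    DirectedSystem X fun i j h => LinearMap.natLERec s i j h where
  map_self i a := by rw [LinearMap.natLERec_self, LinearMap.id_apply]
  map_map k j i hij hjk a := by
    induction k, hjk using Nat.le_induction with
    | base => rw [LinearMap.natLERec_self, LinearMap.id_apply]
    | succ k hjk ih =>
      rw [LinearMap.natLERec_succ s j k hjk, LinearMap.natLERec_succ s i k (hij.trans hjk),
        LinearMap.comp_apply, LinearMap.comp_apply, ih]

end Linear

section Algebra

variable {X : ℕ → Type u} [∀ n, CommRing (X n)] [∀ n, Algebra R (X n)]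
  (s : ∀ n, X n →ₐ[R] X (n + 1))

theorem AlgHom.natLERec_self (i : ℕ) : AlgHom.natLERec s i i le_rfl = AlgHom.id R (X i) :=
  Nat.leRec_self ..

theorem AlgHom.natLERec_succ (i j : ℕ) (h : i ≤ j) :
    AlgHom.natLERec s i (j + 1) (h.trans j.le_succ) = (s j).comp (AlgHom.natLERec s i j h) :=
  Nat.leRec_succ ..

theorem AlgHom.natLERec_step (i : ℕ) : AlgHom.natLERec s i (i + 1) i.le_succ = s i := by
  rw [AlgHom.natLERec_succ s i i le_rfl, AlgHom.natLERec_self, AlgHom.comp_id]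

instance AlgHom.natLERec_directedSystem :
    DirectedSystem X fun i j h => AlgHom.natLERec s i j h where
  map_self i a := by rw [AlgHom.natLERec_self, AlgHom.id_apply]
  map_map k j i hij hjk a := by
    induction k, hjk using Nat.le_induction with
    | base => rw [AlgHom.natLERec_self, AlgHom.id_apply]
    | succ k hjk ih =>
      rw [AlgHom.natLERec_succ s j k hjk, AlgHom.natLERec_succ s i k (hij.trans hjk),
        AlgHom.comp_apply, AlgHom.comp_apply, ih]

end Algebra

theorem isSequentialLimit_mk {X : ℕ → Type u} {T : ∀ ⦃i j : ℕ⦄, i ≤ j → Type*}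
    [∀ ⦃i j⦄ (h : i ≤ j), FunLike (T h) (X i) (X j)] (t : ∀ i j (h : i ≤ j), T h)
    [DirectedSystem X (t · · ·)] :
    IsSequentialLimit (fun i j h => ⇑(t i j h))
      (fun n a => (Quotient.mk _ ⟨n, a⟩ : DirectLimit X t)) where
  map_self i a := DirectedSystem.map_self' t a
  map_map i j k hij hjk a := DirectedSystem.map_map' t hij hjk a
  compat i j h a := DirectLimit.mk_apply i j a h
  surj b := by
    obtain ⟨n, a, rfl⟩ := DirectLimit.exists_eq_mk t b
    exact ⟨n, a, rfl⟩
  eq_of_eq n a a' h := by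
    obtain ⟨m, hm, _, h⟩ := Quotient.eq.1 h
    exact ⟨m, hm, h⟩

/-- Bundled modules let the recursion carry types and structures together; `Q` is whatever is
demanded of a single step. -/
theorem exists_module_tower (Q : ∀ M M' : ModuleCat.{u} R, (M →ₗ[R] M') → Prop)
    (hQ : ∀ M, ∃ M' f, Q M M' f) (M : ModuleCat.{u} R) :
    ∃ (X : ℕ → ModuleCat.{u} R) (t : ∀ i j, i ≤ j → X i →ₗ[R] X j) (L : ModuleCat.{u} R)
      (g : ∀ n, X n →ₗ[R] L), Nonempty (M ≃ₗ[R] X 0) ∧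
      (∀ n, Q (X n) (X (n + 1)) (t n (n + 1) n.le_succ)) ∧
      IsSequentialLimit (fun i j h => t i j h) (fun n => g n) := by
  choose F hF using hQ
  obtain ⟨X, hX₀, hX⟩ : ∃ X : ℕ → ModuleCat.{u} R, Nonempty (M ≃ₗ[R] X 0) ∧
      ∀ n, ∃ f, Q (X n) (X (n + 1)) f :=
    ⟨fun n => Nat.rec M (fun _ => F) n, ⟨LinearEquiv.refl R M⟩, fun n => hF _⟩
  choose s hs using hX
  refine ⟨X, LinearMap.natLERec s, ModuleCat.of R (DirectLimit (fun n => X n)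
    (LinearMap.natLERec s)), DirectLimit.Module.of R ℕ (fun n => X n) (LinearMap.natLERec s),
    hX₀, fun n => ?_, isSequentialLimit_mk _⟩
  rw [LinearMap.natLERec_step]
  exact hs n

theorem exists_algebra_tower (Q : ∀ A A' : CommAlgCat.{u} R, (A →ₐ[R] A') → Prop)
    (hQ : ∀ A, ∃ A' f, Q A A' f) :
    ∃ (X : ℕ → CommAlgCat.{u} R) (t : ∀ i j, i ≤ j → X i →ₐ[R] X j) (L : CommAlgCat.{u} R)
      (g : ∀ n, X n →ₐ[R] L), Function.Bijective (algebraMap R (X 0)) ∧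
      (∀ n, Q (X n) (X (n + 1)) (t n (n + 1) n.le_succ)) ∧
      IsSequentialLimit (fun i j h => t i j h) (fun n => g n) := by
  choose F hF using hQ
  obtain ⟨X, hX₀, hX⟩ : ∃ X : ℕ → CommAlgCat.{u} R, Function.Bijective (algebraMap R (X 0)) ∧
      ∀ n, ∃ f, Q (X n) (X (n + 1)) f :=
    ⟨fun n => Nat.rec (CommAlgCat.of R R) (fun _ => F) n, Function.bijective_id, fun n => hF _⟩
  choose s hs using hX
  refine ⟨X, AlgHom.natLERec s, CommAlgCat.of R (DirectLimit (fun n => X n)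
    (AlgHom.natLERec s)), DirectLimit.Algebra.of (fun n => X n) (AlgHom.natLERec s),
    hX₀, fun n => ?_, isSequentialLimit_mk _⟩
  rw [AlgHom.natLERec_step]
  exact hs n

theorem exists_isSymmetricStep {A : Type u} [CommRing A] [Algebra R A] {P : Type u}
    [AddCommGroup P] [Module R P] (f : A →ₗ[R] P) :
    ∃ (A' : CommAlgCat.{u} R) (g : A →ₐ[R] A'), IsSymmetricStep f g := by
  let q := Ideal.Quotient.mk (symmetricRelations f)
  let i := SymmetricAlgebra.ι R P
  -- The two kinds of generators are precisely the unit and product laws for `A → Sym(P) / I`.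
  have hi1 : 1 - i (f 1) ∈ symmetricRelations f :=
    Ideal.subset_span (Set.mem_union_left _ rfl)
  have himul : ∀ a b, i (f a) * i (f b) - i (f (a * b)) ∈ symmetricRelations f := fun a b =>
    Ideal.subset_span (Set.mem_union_right _ ⟨(a, b), rfl⟩)
  have h1 : q (i (f 1)) = 1 := by
    rw [← map_one q]
    exact ((Ideal.Quotient.mk_eq_mk_iff_sub_mem _ _).2 hi1).symm
  have hmul : ∀ a b, q (i (f (a * b))) = q (i (f a)) * q (i (f b)) := fun a b => by
    rw [← map_mul q]
    exact ((Ideal.Quotient.mk_eq_mk_iff_sub_mem _ _).2 (himul a b)).symm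
  exact ⟨CommAlgCat.of R (SymmetricAlgebra R P ⧸ symmetricRelations f),
    AlgHom.ofLinearMap ((Ideal.Quotient.mkₐ R _).toLinearMap ∘ₗ i ∘ₗ f) h1 hmul, AlgEquiv.refl,
    fun a => rfl⟩

end Towers

/-! ### Existence of modifications and of both constructions -/

section Existence

variable {R : Type u} [CommRing R] [IsLocalRing R]

/-- The type of all parameter relations in `M` lies in the same universe as `M`, so it can index the
family itself; one step then trivializes every relation. -/
theorem exists_isModuleModification (M : ModuleCat.{u} R) :
    ∃ (M' : ModuleCat.{u} R) (f : M →ₗ[R] M'),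
      IsModuleModification f ∧ ∀ ρ : ParameterRelation R M, ρ.TrivializedBy f := by
  let q := (moduleModificationRelations (fun ρ : ParameterRelation R M => ρ)).mkQ
  refine ⟨ModuleCat.of R ((M × ((Σ ρ : ParameterRelation R M, Fin ρ.k) →₀ R)) ⧸
    moduleModificationRelations (fun ρ : ParameterRelation R M => ρ)),
    q ∘ₗ LinearMap.inl R _ _, ⟨_, _, LinearEquiv.refl R _, fun m => rfl⟩, fun ρ => ?_⟩
  refine ⟨fun j => q (0, Finsupp.single ⟨ρ, j⟩ 1), ?_⟩
  change q (ρ.lead, 0) = ∑ j, ρ.x j • q (0, Finsupp.single ⟨ρ, j⟩ 1)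
  simp only [← map_smul, ← map_sum]
  refine (Submodule.Quotient.eq _).2 (Submodule.subset_span ⟨ρ, ?_⟩)
  ext1 <;> simp [Prod.fst_sum, Prod.snd_sum]

theorem exists_isAlgebraModification (S : CommAlgCat.{u} R) :
    ∃ (S' : CommAlgCat.{u} R) (f : S →ₐ[R] S'), IsAlgebraModification f ∧
      ∀ ρ : ParameterRelation R S, ρ.TrivializedBy f.toLinearMap := by
  let I := algebraModificationRelations (fun ρ : ParameterRelation R S => ρ)
  let q := Ideal.Quotient.mkₐ R I
  refine ⟨CommAlgCat.of R (MvPolynomial (Σ ρ : ParameterRelation R S, Fin ρ.k) S ⧸ I),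
    q.comp (IsScalarTower.toAlgHom R S _), ⟨_, _, AlgEquiv.refl, fun m => rfl⟩, fun ρ => ?_⟩
  refine ⟨fun j => q (MvPolynomial.X ⟨ρ, j⟩), ?_⟩
  change q (MvPolynomial.C ρ.lead) = ∑ j, ρ.x j • q (MvPolynomial.X ⟨ρ, j⟩)
  simp only [← map_smul, ← map_sum]
  exact Ideal.Quotient.eq.2 (Ideal.subset_span ⟨ρ, rfl⟩)

theorem exists_moduleModificationConstruction (M : ModuleCat.{u} R) :
    ∃ (P : ModuleCat.{u} R) (f : M →ₗ[R] P), Nonempty (ModuleModificationConstruction f) := by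
  obtain ⟨X, t, P, g, ⟨e⟩, hX, hP⟩ := exists_module_tower (R := R)
    (fun M M' f => IsModuleModification f ∧ ∀ ρ : ParameterRelation R M, ρ.TrivializedBy f)
    exists_isModuleModification M
  exact ⟨P, g 0 ∘ₗ e.toLinearMap, ⟨{
    N := fun n => X n
    base := e
    trans := t
    step := fun n => (hX n).1
    trivialized := fun n ρ => ⟨n + 1, n.le_succ, (hX n).2 ρ⟩
    toLimit := g
    isLimit := hP
    map_eq := fun _ => rfl }⟩⟩

variable (R) in
theorem exists_algebraModificationConstruction :
    ∃ (B : Type u) (_ : CommRing B) (_ : Algebra R B),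
      Nonempty (AlgebraModificationConstruction R B) := by
  obtain ⟨X, t, B, g, h₀, hX, hB⟩ := exists_algebra_tower (R := R)
    (fun S S' f => IsAlgebraModification f ∧
      ∀ ρ : ParameterRelation R S, ρ.TrivializedBy f.toLinearMap) exists_isAlgebraModification
  exact ⟨B, inferInstance, inferInstance, ⟨{
    S := fun n => X n
    base := h₀
    trans := t
    step := fun n => (hX n).1
    trivialized := fun n ρ => ⟨n + 1, n.le_succ, (hX n).2 ρ⟩
    toLimit := g
    isLimit := hB }⟩⟩

variable (R) in
theorem exists_symmetricAlgebraConstruction :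
    ∃ (B : Type u) (_ : CommRing B) (_ : Algebra R B),
      Nonempty (SymmetricAlgebraConstruction R B) := by
  obtain ⟨X, t, B, g, h₀, hX, hB⟩ := exists_algebra_tower (R := R)
    -- The tower records only the algebras; the intermediate modules are hidden in the step property
    -- and recovered afterwards by choice.
    (fun A A' g => ∃ (P : ModuleCat.{u} R) (f : A →ₗ[R] P),
      Nonempty (ModuleModificationConstruction f) ∧ IsSymmetricStep f g) (fun A => by
    obtain ⟨P, f, hf⟩ := exists_moduleModificationConstruction (ModuleCat.of R A)
    obtain ⟨A', g, hg⟩ := exists_isSymmetricStep (A := A) f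
    exact ⟨A', g, P, f, hf, hg⟩)
  choose P f hf hg using hX
  exact ⟨B, inferInstance, inferInstance, ⟨{
    A := fun n => X n
    base := h₀
    P := fun n => P n
    f := f
    modification := fun n => (hf n).some
    trans := t
    step := hg
    toLimit := g
    isLimit := hB }⟩⟩

end Existence

/-! ### The smallest big Cohen–Macaulay algebra closure -/

theorem mainTheorem6 (R : Type u) [CommRing R] [IsLocalRing R] [IsNoetherianRing R]
    (hR : ∃ (B : Type u) (_ : CommRing B) (_ : Algebra R B), IsBigCMAlgebra R B) :
    ∃ c : ClosureOperation R,
      IsLeast {c' : ClosureOperation R | IsBigCMAlgebraClosure R c'} c ∧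
      ((∃ (B : Type u) (_ : CommRing B) (_ : Algebra R B),
          Nonempty (SymmetricAlgebraConstruction R B)) ∧
        ∀ (B : Type u) [CommRing B] [Algebra R B], SymmetricAlgebraConstruction R B →
          IsBigCMAlgebra R B ∧ algebraClosure R B = c) ∧
      ((∃ (B : Type u) (_ : CommRing B) (_ : Algebra R B),
          Nonempty (AlgebraModificationConstruction R B)) ∧
        ∀ (B : Type u) [CommRing B] [Algebra R B], AlgebraModificationConstruction R B →
          IsBigCMAlgebra R B ∧ algebraClosure R B = c) := by
  obtain ⟨C, _, _, hC⟩ := hR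
  -- Trivial relations and weak initiality among algebras with trivial relations are all that is
  -- needed from `B`; the given `C` only ensures properness.
  have hleast : ∀ (B : Type u) [CommRing B] [Algebra R B], RelationsTrivial R B →
      (∀ (D : Type u) [CommRing D] [Algebra R D], RelationsTrivial R D →
        Nonempty (B →ₐ[R] D)) →
      IsBigCMAlgebra R B ∧
        IsLeast {c' : ClosureOperation R | IsBigCMAlgebraClosure R c'} (algebraClosure R B) := by
    intro B _ _ hB hmap
    have hBCM := hC.of_algHom (hmap C hC.relationsTrivial).some hB
    refine ⟨hBCM, ⟨B, _, _, hBCM, rfl⟩, ?_⟩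
    rintro _ ⟨D, _, _, hD, rfl⟩
    exact algebraClosure_le_of_algHom (hmap D hD.relationsTrivial).some
  obtain ⟨B₀, _, _, ⟨hB₀⟩⟩ := exists_algebraModificationConstruction R
  have h₀ := (hleast B₀ hB₀.relationsTrivial fun _ => hB₀.nonempty_algHom).2
  refine ⟨algebraClosure R B₀, h₀, ⟨exists_symmetricAlgebraConstruction R, fun B _ _ hB => ?_⟩,
    exists_algebraModificationConstruction R, fun B _ _ hB => ?_⟩
  · have h := hleast B hB.relationsTrivial fun _ => hB.nonempty_algHom
    exact ⟨h.1, h.2.unique h₀⟩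
  · have h := hleast B hB.relationsTrivial fun _ => hB.nonempty_algHom
    exact ⟨h.1, h.2.unique h₀⟩
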